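/- Let $p$ be a prime number and let $K$ be a (non-archimedean) local field of characteristic $p$, with finite residue field $k$. Let $L$ be a finite galoisian extension of $K$ with group $G=\mathrm{Gal}(L|K)$ and inertia subgroup $T\subset G$. Suppose that $L|K$ is tamely ramified (its ramification index is prime to $p$) and split, in the sense that the short exact sequence $1\to T\to G\to G/T\to 1$ has a section which is a morphism of groups. Let $\mathfrak{p}_L$ be the unique maximal ideal of the ring of integers $\mathfrak{o}_L$ of $L$, put $U_L^1=1+\mathfrak{p}_L$, and let $\bar U_L^1$ be the image of $U_L^1$ in $L^\times/L^{\times p}$; it is a submodule of the $\mathbf{F}_p[G]$-module $L^\times/L^{\times p}$. Then the $\mathbf{F}_p[G]$-module $\bar U_L^1$ is isomorphic to $k[G]^{\mathbf{N}}$ and to $\mathbf{F}_p[G]^{\mathbf{N}}$, where $M^{\mathbf{N}}$ denotes the direct product of countably many copies of $M$, and $k[G]$ is viewed as an $\mathbf{F}_p[G]$-module through $\mathbf{F}_p\subset k$. -/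

import Mathlib

open scoped ValuativeRel

namespace LittleGalois

/-! ### The ring of integers of a finite extension of a local field is local -/

section LocalRing

variable (K : Type*) [Field K] [ValuativeRel K] [TopologicalSpace K]
  [IsNonarchimedeanLocalField K]
variable (L : Type*) [Field L] [Algebra K L] [FiniteDimensional K L]

/-- The absolute value of `K` extends to `L`, and its unit ball is the integral closure of the
ring of integers of `K`. -/
theorem exists_absoluteValue :
    ∃ N : L →*₀ ℝ, IsNonarchimedean N ∧ (∀ x, 0 ≤ N x) ∧ ∀ x : L, N x ≤ 1 ↔ IsIntegral 𝒪[K] x := by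
  let := IsTopologicalAddGroup.rightUniformSpace K
  have := isUniformAddGroup_of_addCommGroup (G := K)
  let : (Valued.v (R := K) (Γ₀ := ValuativeRel.ValueGroupWithZero K)).RankOne :=
  { hom' := ValuativeRel.IsRankLeOne.nonempty.some.emb (R := K).comp
      MonoidWithZeroHom.ValueGroup₀.embedding
    strictMono' := ValuativeRel.IsRankLeOne.nonempty.some.strictMono.comp
        MonoidWithZeroHom.ValueGroup₀.embedding_strictMono }
  let : NontriviallyNormedField K :=
    Valued.toNontriviallyNormedField K (ValuativeRel.ValueGroupWithZero K)
  have hle : ∀ x : K, ‖x‖ ≤ 1 ↔ x ∈ 𝒪[K] := fun x =>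
    Valued.toNormedField.norm_le_one_iff
  have : IsUltrametricDist K := inferInstance
  have : CompleteSpace K := inferInstance
  have : IsIntegrallyClosed 𝒪[K] := inferInstance
  refine ⟨⟨⟨spectralNorm K L, spectralNorm_zero⟩, spectralNorm_one, spectralAlgNorm_mul⟩,
    isNonarchimedean_spectralNorm, spectralNorm_nonneg, fun x => ?_⟩
  have hx : IsIntegral K x := Algebra.IsIntegral.isIntegral x
  change spectralValue (minpoly K x) ≤ 1 ↔ _
  rw [spectralValue_le_one_iff (minpoly.monic hx)]
  constructor
  · intro h
    have hl : minpoly K x ∈ Polynomial.lifts (algebraMap 𝒪[K] K) := by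
      rw [Polynomial.lifts_iff_coeff_lifts]
      exact fun n => ⟨⟨_, (hle _).1 (h n)⟩, rfl⟩
    obtain ⟨q, hq, -, hqm⟩ :=
      Polynomial.lifts_and_natDegree_eq_and_monic hl (minpoly.monic hx)
    refine ⟨q, hqm, ?_⟩
    have := minpoly.aeval K x
    rw [← hq, Polynomial.aeval_map_algebraMap] at this
    exact this
  · intro h n
    rw [minpoly.isIntegrallyClosed_eq_field_fractions' K h, Polynomial.coeff_map]
    exact (hle _).2 ((minpoly 𝒪[K] x).coeff n).2

/-- The ring of integers `𝔬_L` (the integral closure of `𝔬_K` in `L`) is a local ring. -/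
instance isLocalRing_integralClosure : IsLocalRing (integralClosure 𝒪[K] L) := by
  obtain ⟨N, hN, hN0, hint⟩ := exists_absoluteValue K L
  have hu : ∀ x : integralClosure 𝒪[K] L, x ∈ nonunits _ ↔ N x < 1 := by
    intro x
    have hx1 : N x ≤ 1 := (hint _).2 x.2
    rw [mem_nonunits_iff, ← not_le, not_iff_not]
    constructor
    · rintro ⟨u, rfl⟩
      have h1 : N (u : integralClosure 𝒪[K] L) * N (u⁻¹ : (integralClosure 𝒪[K] L)ˣ) = 1 := by
        rw [← map_mul, ← MulMemClass.coe_mul, Units.mul_inv]; simp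
      have h2 : N ((u⁻¹ : (integralClosure 𝒪[K] L)ˣ) : integralClosure 𝒪[K] L) ≤ 1 :=
        (hint _).2 (Subtype.prop _)
      rw [← h1]
      exact mul_le_of_le_one_right (hN0 _) h2
    · intro h
      have hNx : N x = 1 := le_antisymm hx1 h
      have hx0 : (x : L) ≠ 0 := by
        intro h0; rw [h0, map_zero] at hNx; exact zero_ne_one hNx
      have hinv : N (x : L)⁻¹ ≤ 1 := by rw [map_inv₀, hNx, inv_one]
      refine IsUnit.of_mul_eq_one ⟨(x : L)⁻¹, (hint _).1 hinv⟩ ?_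
      ext
      simp [hx0]
  refine IsLocalRing.of_nonunits_add fun a b ha hb => ?_
  rw [hu] at ha hb ⊢
  exact (hN _ _).trans_lt (max_lt ha hb)

end LocalRing

/-! ### Ramification -/

section Ramification

variable (K : Type*) [Field K] [ValuativeRel K] [TopologicalSpace K]
  [IsNonarchimedeanLocalField K]
variable (L : Type*) [Field L] [Algebra K L] [FiniteDimensional K L]

/-- The ring of integers `𝔬_L` of `L`. -/
abbrev RingOfIntegers : Type _ := integralClosure 𝒪[K] L

/-- The unique maximal ideal `𝔭_L` of `𝔬_L`. -/
noncomputable abbrev maxIdeal : Ideal (RingOfIntegers K L) := IsLocalRing.maximalIdeal (RingOfIntegers K L)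

/-- `L | K` is tamely ramified: its ramification index is prime to the residue characteristic `p`
(the residue fields are finite, so the residue extension is always separable). -/
def IsTamelyRamified (p : ℕ) : Prop :=
  ¬ p ∣ (maxIdeal K L).ramificationIdx 𝒪[K]

/-- The inertia subgroup `T` of `G = Gal(L | K)`: the automorphisms that act trivially
on `𝔬_L / 𝔭_L`. -/
noncomputable def inertiaGroup : Subgroup Gal(L/K) := (maxIdeal K L).inertia Gal(L/K)

variable {K L} in
theorem smul_mem_maxIdeal (g : Gal(L/K)) {x : RingOfIntegers K L} (hx : x ∈ maxIdeal K L) :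
    g • x ∈ maxIdeal K L := by
  rw [IsLocalRing.mem_maximalIdeal, mem_nonunits_iff] at hx ⊢
  intro h
  apply hx
  have := h.map (MulSemiringAction.toRingHom Gal(L/K) (RingOfIntegers K L) g⁻¹)
  simpa using this

instance inertiaGroup_normal : (inertiaGroup K L).Normal where
  conj_mem t ht g x := by
    have h := smul_mem_maxIdeal g (ht (g⁻¹ • x))
    simpa [smul_sub, mul_smul] using h

/-- `L | K` is split: the exact sequence `1 → T → G → G / T → 1` has a section which is
a morphism of groups. -/
def IsSplit : Prop :=
  ∃ s : Gal(L/K) ⧸ inertiaGroup K L →* Gal(L/K),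
    ∀ x, QuotientGroup.mk' (inertiaGroup K L) (s x) = x

/-- The group `U_L^1 = 1 + 𝔭_L` of principal units, as a subgroup of `Lˣ`. -/
def principalUnits : Subgroup Lˣ where
  carrier := {u | ∃ x ∈ maxIdeal K L, (u : L) = 1 + (x : L)}
  one_mem' := ⟨0, zero_mem _, by simp⟩
  mul_mem' := by
    rintro u v ⟨x, hx, hu⟩ ⟨y, hy, hv⟩
    refine ⟨x + y + x * y, add_mem (add_mem hx hy) (Ideal.mul_mem_right _ _ hx), ?_⟩
    push_cast
    rw [hu, hv]
    ring
  inv_mem' := by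
    rintro u ⟨x, hx, hu⟩
    have h1 : IsUnit (1 + x) := by
      by_contra h
      have h' : 1 + x ∈ maxIdeal K L := h
      exact (IsLocalRing.maximalIdeal.isMaximal (RingOfIntegers K L)).ne_top
        ((Ideal.eq_top_iff_one _).2 (by simpa using sub_mem h' hx))
    obtain ⟨w, hw⟩ := h1
    have hwu : (u : L) = ((w : RingOfIntegers K L) : L) := by rw [hu, hw]; simp
    have hwL : ((w : RingOfIntegers K L) : L) * (((w⁻¹ : (RingOfIntegers K L)ˣ) :
        RingOfIntegers K L) : L) = 1 := by
      have h := congrArg (algebraMap (RingOfIntegers K L) L) (Units.mul_inv w)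
      rw [map_mul, map_one] at h
      exact h
    have hinv : ((u⁻¹ : Lˣ) : L) = (((w⁻¹ : (RingOfIntegers K L)ˣ) : RingOfIntegers K L) : L) := by
      rw [Units.val_inv_eq_inv_val, hwu]
      exact inv_eq_of_mul_eq_one_right hwL
    refine ⟨-x * (w⁻¹ : (RingOfIntegers K L)ˣ), Ideal.mul_mem_right _ _ (neg_mem hx), ?_⟩
    rw [hinv]
    have hx' : x = w - 1 := by rw [hw]; ring
    rw [hx']
    push_cast
    linear_combination hwL

end Ramification

/-! ### The `𝔽_p[G]`-module `Lˣ / Lˣᵖ` -/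

section UnitsModPow

variable (p : ℕ) (L : Type*) [Field L]

/-- The group `Lˣ / Lˣᵖ`, written additively. -/
def UnitsModPow : Type _ := Additive (Lˣ ⧸ (powMonoidHom p : Lˣ →* Lˣ).range)

instance : AddCommGroup (UnitsModPow p L) :=
  inferInstanceAs (AddCommGroup (Additive (Lˣ ⧸ (powMonoidHom p : Lˣ →* Lˣ).range)))

/-- The projection `Lˣ → Lˣ / Lˣᵖ`. -/
def UnitsModPow.mk : Additive Lˣ →+ UnitsModPow p L :=
  MonoidHom.toAdditive (QuotientGroup.mk' (powMonoidHom p : Lˣ →* Lˣ).range)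

variable {p L} in
theorem UnitsModPow.mk_surjective : Function.Surjective (UnitsModPow.mk p L) :=
  QuotientGroup.mk'_surjective (powMonoidHom p : Lˣ →* Lˣ).range

variable {p L} in
theorem UnitsModPow.nsmul_eq_zero (x : UnitsModPow p L) : p • x = 0 := by
  obtain ⟨u, rfl⟩ := UnitsModPow.mk_surjective x
  rw [← map_nsmul]
  exact (QuotientGroup.eq_one_iff _).2 ⟨u.toMul, rfl⟩

instance : Module (ZMod p) (UnitsModPow p L) :=
  AddCommGroup.zmodModule UnitsModPow.nsmul_eq_zero

variable (K : Type*) [Field K] [Algebra K L]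

/-- The map induced on `Lˣ / Lˣᵖ` by an automorphism of `L`. -/
def UnitsModPow.map (g : Gal(L/K)) : UnitsModPow p L →+ UnitsModPow p L :=
  MonoidHom.toAdditive (QuotientGroup.map (powMonoidHom p : Lˣ →* Lˣ).range
    (powMonoidHom p : Lˣ →* Lˣ).range (Units.map (g : L →* L)) (by
      rintro _ ⟨u, rfl⟩
      exact ⟨Units.map (g : L →* L) u, by simp⟩))

variable {p L K} in
theorem UnitsModPow.map_mk (g : Gal(L/K)) (u : Lˣ) :
    UnitsModPow.map p L K g (UnitsModPow.mk p L (Additive.ofMul u)) =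
      UnitsModPow.mk p L (Additive.ofMul (Units.map (g : L →* L) u)) := rfl

/-- The representation of `G = Gal(L | K)` on the `𝔽_p`-space `Lˣ / Lˣᵖ`. -/
def unitsRep : Representation (ZMod p) Gal(L/K) (UnitsModPow p L) where
  toFun g := (UnitsModPow.map p L K g).toZModLinearMap p
  map_one' := by
    ext x
    obtain ⟨u, rfl⟩ := UnitsModPow.mk_surjective x
    rfl
  map_mul' g h := by
    ext x
    obtain ⟨u, rfl⟩ := UnitsModPow.mk_surjective x
    rfl

end UnitsModPow

section MainModule

variable (p : ℕ)
variable (K : Type*) [Field K] [ValuativeRel K] [TopologicalSpace K]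
  [IsNonarchimedeanLocalField K]
variable (L : Type*) [Field L] [Algebra K L] [FiniteDimensional K L]

/-- The image of `U_L^1` in `Lˣ / Lˣᵖ`, as a subrepresentation. -/
def principalUnitsSubrep : Subrepresentation (unitsRep p L K) where
  toSubmodule := AddSubgroup.toZModSubmodule p
    ((Subgroup.toAddSubgroup (principalUnits K L)).map (UnitsModPow.mk p L))
  apply_mem_toSubmodule := by
    rintro g _ ⟨u, ⟨x, hx, hu⟩, rfl⟩
    refine ⟨Additive.ofMul (Units.map (g : L →* L) u.toMul),
      ⟨g • x, smul_mem_maxIdeal g hx, ?_⟩, rfl⟩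
    change g (u.toMul : L) = 1 + g (x : L)
    rw [← map_one g, ← map_add]
    exact congrArg g hu

/-- The `𝔽_p[G]`-submodule `Ū_L^1` of `Lˣ / Lˣᵖ`: the image of `U_L^1`. -/
def UbarOne : Submodule (MonoidAlgebra (ZMod p) Gal(L/K)) (unitsRep p L K).asModule :=
  (principalUnitsSubrep p K L).asSubmodule

end MainModule

/-! ### The `𝔽_p[G]`-module `k[G]` -/

section GroupAlgebra

variable (p : ℕ)

/-- The residue field of a local field of characteristic `p` has characteristic `p`. -/
theorem charP_residueField [Fact p.Prime] (K : Type*) [Field K] [ValuativeRel K] [CharP K p] :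
    CharP 𝓀[K] p := by
  have h : (p : 𝒪[K]) = 0 := Subtype.ext (by simp)
  have h' : (p : 𝓀[K]) = 0 := by
    rw [← map_natCast (IsLocalRing.residue 𝒪[K]), h, map_zero]
  exact (CharP.charP_iff_prime_eq_zero (Fact.out : p.Prime)).2 h'

/-- For a ring `k` of characteristic `p`, the group algebra `k[G]` is an `𝔽_p[G]`-module through
the ring homomorphism `𝔽_p[G] → k[G]` induced by `𝔽_p → k`. -/
noncomputable abbrev groupAlgebraModule (k : Type*) [CommRing k] [CharP k p]
    (G : Type*) [Group G] :
    Module (MonoidAlgebra (ZMod p) G) (MonoidAlgebra k G) :=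
  Module.compHom (MonoidAlgebra k G)
    (MonoidAlgebra.mapRingHom G (ZMod.castHom (dvd_refl p) k))

noncomputable instance residueGroupAlgebraModule [Fact p.Prime] (K : Type*) [Field K]
    [ValuativeRel K] [CharP K p] (G : Type*) [Group G] :
    Module (MonoidAlgebra (ZMod p) G) (MonoidAlgebra 𝓀[K] G) :=
  have := charP_residueField p K
  groupAlgebraModule p 𝓀[K] G

end GroupAlgebra

end LittleGalois

/-! Write `R` for the ring of integers of `L`, `l` for its residue field, `Q = G / T`, `e = |T|`.
Modulo `p`-th powers, the filtration of the principal units by the powers of the maximal ideal has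
graded piece `0` at levels divisible by `p` (`l` is perfect) and `l` at the other levels. For a
uniformizer `ϖ` with `g ϖ = v_g ϖ`, the action on the piece of level `j` is `w ↦ χ(g) ^ j * g w`,
where `χ(g)` is the residue of `v_g`.

Tameness makes `e` invertible in `l`. With surjectivity of the trace of `l` this gives `c` with `∑ g
• c = 1`, so every graded piece is relatively projective and the complete separated filtration
splits equivariantly (`exists_equivariant_bijOn`): the module is the product of the twists `l(χ ^
j)` over `j` prime to `p`.

The splitting lets `Q` act on `R`, and `Q` fixes some `ϖ`; then `χ ^ e = 1`, and `χ` is injective on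
`T`. Each class modulo `e` contains infinitely many `j` prime to `p`, so the product consists of
countably many blocks `⊕_{i < e} l(χ ^ i)`. By a normal basis and a Vandermonde determinant each
block is `κ[G]`, with `κ` the subfield of `l` fixed by `Q` (`exists_addEquiv_twist`). Finally `κ ^
ℕ`, `k ^ ℕ` and `𝔽_p ^ ℕ` are isomorphic groups, so the coefficient field is immaterial. -/

namespace LittleGalois

/-! ### Equivariant splitting of complete filtrations. -/

section Filtration

variable {k₀ G X W : Type*} [Field k₀] [Group G] [Fintype G] [AddCommGroup X] [Module k₀ X]
  [AddCommGroup W] [Module k₀ W]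

/-- A complete separated filtered representation whose graded pieces are relatively projective is
the product of its graded pieces. -/
theorem exists_equivariant_bijOn (ρ : Representation k₀ G X) (F : ℕ → Submodule k₀ X)
    (hanti : ∀ i, F (i + 1) ≤ F i) (J : Set ℕ)
    (σ : ℕ → Representation k₀ G W) (c : W →ₗ[k₀] W)
    (hc : ∀ i w, ∑ g, σ i g (c (σ i g⁻¹ w)) = w) (f : ℕ → X →ₗ[k₀] W)
    (hfσ : ∀ i ∈ J, ∀ g, ∀ x ∈ F i, f i (ρ g x) = σ i g (f i x))
    (hfker : ∀ i ∈ J, ∀ x ∈ F i, f i x = 0 ↔ x ∈ F (i + 1))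
    (hfsurj : ∀ i ∈ J, ∀ w, ∃ x ∈ F i, f i x = w)
    (hJ : ∀ i ∉ J, F i ≤ F (i + 1)) (hsep : ∀ x, (∀ i, x ∈ F i) → x = 0)
    (hcomplete : ∀ x : ℕ → X, (∀ i, x i ∈ F i) →
      ∃ y ∈ F 0, ∀ n, y - ∑ j ∈ Finset.range n, x j ∈ F n) :
    ∃ r : X →ₗ[k₀] (J → W), (∀ g x j, r (ρ g x) j = σ j g (r x j)) ∧
      Set.BijOn r (F 0 : Set X) Set.univ := by
  classical
  -- Averaging `c ∘ f j` over `G` gives a map equivariant on all of `X`; by `hc` it still agrees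
  -- with `f j` on `F j`.
  let r : X →ₗ[k₀] (J → W) :=
    LinearMap.pi fun j => ∑ g, σ j g ∘ₗ c ∘ₗ f j ∘ₗ ρ g⁻¹
  have hr : ∀ x j, r x j = ∑ g, σ j g (c (f j (ρ g⁻¹ x))) := fun x j => by
    simp [r, LinearMap.sum_apply]
  have hrF : ∀ j : J, ∀ x ∈ F j, r x j = f j x := fun j x hx => by
    rw [hr, ← hc j (f j x)]
    exact Finset.sum_congr rfl fun g _ => by rw [hfσ j j.2 g⁻¹ x hx]
  have heq : ∀ g x j, r (ρ g x) j = σ j g (r x j) := fun g x j => by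
    rw [hr, hr, map_sum, ← Equiv.sum_comp (Equiv.mulLeft g)]
    refine Finset.sum_congr rfl fun h _ => ?_
    simp only [Equiv.coe_mulLeft, map_mul, Module.End.mul_apply, mul_inv_rev]
    rw [← Module.End.mul_apply (ρ g⁻¹), ← map_mul, inv_mul_cancel, map_one, Module.End.one_apply]
  have hinj : ∀ x ∈ F 0, r x = 0 → x = 0 := fun x hx h0 => by
    refine hsep x fun n => ?_
    induction n with
    | zero => exact hx
    | succ n ih =>
      by_cases hn : n ∈ J
      · rw [← hfker n hn x ih, ← hrF ⟨n, hn⟩ x ih, h0]; rfl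
      · exact hJ n hn ih
  refine ⟨r, heq, fun _ _ => Set.mem_univ _, fun x hx y hy h => ?_, fun w _ => ?_⟩
  · exact sub_eq_zero.1 (hinj _ (sub_mem hx hy) (by rw [map_sub, h, sub_self]))
  · choose! pick hpickF hpick using hfsurj
    -- Successive approximation: level `n` corrects coordinate `n`, and later corrections lie in `F
    -- (n + 1)`, where that coordinate of `r` vanishes.
    let step : ℕ → X → X := fun n s =>
      if h : n ∈ J then pick n (w ⟨n, h⟩ - r s ⟨n, h⟩) else 0
    let s : ℕ → X := fun n => Nat.rec 0 (fun n s => s + step n s) n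
    have hs : ∀ n, s n = ∑ j ∈ Finset.range n, step j (s j) := fun n => by
      induction n with
      | zero => rfl
      | succ n ih => rw [Finset.sum_range_succ, ← ih]
    have hstep : ∀ n, step n (s n) ∈ F n := fun n => by
      by_cases h : n ∈ J
      · simpa [step, h] using hpickF n h _
      · simp [step, h]
    obtain ⟨y, hy, hyn⟩ := hcomplete (fun n => step n (s n)) hstep
    refine ⟨y, hy, funext fun j => ?_⟩
    have h1 := hyn (j + 1)
    rw [← hs] at h1
    have h2 : r (y - s (j + 1)) j = 0 := by
      rw [hrF j _ (hanti _ h1), hfker j j.2 _ (hanti _ h1)]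
      exact h1
    have h3 : s (j + 1) = s j + step j (s j) := rfl
    rw [map_sub, Pi.sub_apply, sub_eq_zero, h3, map_add, Pi.add_apply,
      hrF j _ (hstep j)] at h2
    rw [h2]
    simp only [step, Subtype.coe_prop, dite_true, hpick _ j.2]
    simp

/-- A functional additive relation between vector spaces extends to a linear map. -/
theorem exists_linearMap_of_graph (Γ : Submodule k₀ (X × W))
    (hΓ : ∀ w, ((0 : X), w) ∈ Γ → w = 0) :
    ∃ f : X →ₗ[k₀] W, ∀ x w, (x, w) ∈ Γ → f x = w := by
  have hΓ' : ∀ x ∈ Γ, x.1 = 0 → x.2 = 0 := by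
    rintro ⟨x, w⟩ h rfl
    exact hΓ w h
  obtain ⟨f, hf⟩ := LinearMap.exists_extend Γ.toLinearPMap.toFun
  refine ⟨f, fun x w h => ?_⟩
  rw [← Submodule.toLinearPMap_graph_eq Γ hΓ', LinearPMap.mem_graph_iff] at h
  obtain ⟨y, rfl, rfl⟩ := h
  exact LinearMap.congr_fun hf y

end Filtration

/-! ### Crossed characters and the regular representation. -/

section Twist

/-- A split surjection `φ : G → Q` identifies `G` with `ker φ × Q`. -/
def kerProdEquiv {G Q : Type*} [Group G] [Group Q] (φ : G →* Q) (s : Q →* G)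
    (hs : ∀ q, φ (s q) = q) : φ.ker × Q ≃ G where
  toFun a := a.1 * s a.2
  invFun g := (⟨g * s (φ g)⁻¹, by simp [MonoidHom.mem_ker, hs]⟩, φ g)
  left_inv := fun ⟨⟨t, ht⟩, q⟩ => by
    rw [MonoidHom.mem_ker] at ht
    simp [ht, hs]
  right_inv g := by simp

theorem map_kerProdEquiv {G Q : Type*} [Group G] [Group Q] (φ : G →* Q) (s : Q →* G)
    (hs : ∀ q, φ (s q) = q) (a : φ.ker × Q) : φ (kerProdEquiv φ s hs a) = a.2 := by
  have : φ (a.1 : G) = 1 := a.1.2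
  change φ (_ * _) = _
  rw [map_mul, hs, this, one_mul]

theorem crossedHom_kerProdEquiv {l G Q : Type*} [Field l] [Group G] [Group Q]
    [MulSemiringAction Q l] (φ : G →* Q) (s : Q →* G) (hs : ∀ q, φ (s q) = q) (χ : G → l)
    (hχ : ∀ g h, χ (g * h) = χ g * φ g • χ h) (hχs : ∀ q, χ (s q) = 1) (a : φ.ker × Q) :
    χ (kerProdEquiv φ s hs a) = χ a.1 := by
  change χ (_ * s _) = _
  rw [hχ, hχs, smul_one, mul_one]

/-- The kernel acts trivially on `l`, so `χ` is multiplicative there; being trivial on the section,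
`χ` takes no other values on `G`. -/
theorem crossedHom_pow_card_ker {l G Q : Type*} [Field l] [Group G] [Group Q]
    [MulSemiringAction Q l] (φ : G →* Q) (s : Q →* G) (hs : ∀ q, φ (s q) = q) (χ : G → l)
    (hχ : ∀ g h, χ (g * h) = χ g * φ g • χ h) (hχs : ∀ q, χ (s q) = 1) (g : G) :
    χ g ^ Nat.card φ.ker = 1 := by
  obtain ⟨⟨t, q⟩, rfl⟩ := (kerProdEquiv φ s hs).surjective g
  rw [crossedHom_kerProdEquiv φ s hs χ hχ hχs]
  have h1 : χ 1 = 1 := by rw [← map_one s, hχs]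
  have hpow : ∀ n : ℕ, χ ((t : G) ^ n) = χ t ^ n := fun n => by
    induction n with
    | zero => simp [h1]
    | succ n ih =>
      have ht : φ (t : G) = 1 := t.2
      rw [pow_succ, hχ, ih, map_pow, ht, one_pow, one_smul, pow_succ]
  rw [← hpow, ← Subgroup.coe_pow, pow_card_eq_one', Subgroup.coe_one, h1]

/-- A faithful linear combination of automorphisms of a field is not identically zero. -/
theorem exists_sum_mul_smul_ne_zero {l Q : Type*} [Field l] [Group Q] [Fintype Q]
    [MulSemiringAction Q l] [FaithfulSMul Q l] (u : Q → l) (hu : u 1 ≠ 0) :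
    ∃ a : l, ∑ q, u q * q • a ≠ 0 := by
  by_contra! h
  have hli := (linearIndependent_monoidHom l l).comp
    (fun q : Q => (MulSemiringAction.toRingHom Q l q : l →* l)) fun q q' h =>
      eq_of_smul_eq_smul fun x => DFunLike.congr_fun h x
  refine hu (Fintype.linearIndependent_iff.1 hli u (funext fun a => ?_) 1)
  simpa [Finset.sum_apply] using h a

/-- Some `a` has nonzero trace `b` over `Q`, by independence of automorphisms. Summing over `G`
counts each element of `Q` `|ker φ|` times, so `a / (b * |ker φ|)` works. This is the element needed
for relative projectivity. -/
theorem exists_sum_smul_eq_one {l G Q : Type*} [Field l] [Group G] [Fintype G] [Group Q]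
    [Finite Q] [MulSemiringAction Q l] [FaithfulSMul Q l] (φ : G →* Q) (s : Q →* G)
    (hs : ∀ q, φ (s q) = q) (hcard : (Nat.card φ.ker : l) ≠ 0) :
    ∃ c : l, ∑ g, φ g • c = 1 := by
  classical
  have := Fintype.ofFinite Q
  obtain ⟨a, ha⟩ := exists_sum_mul_smul_ne_zero (fun _ : Q => (1 : l)) one_ne_zero
  simp_rw [one_mul] at ha
  set b := ∑ q : Q, q • a
  have hb : ∀ q : Q, q • b = b := fun q => by
    simp only [b, Finset.smul_sum, ← mul_smul]
    exact Equiv.sum_comp (Equiv.mulLeft q) fun q => q • a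
  have hn : ∀ q : Q, q • (Nat.card φ.ker : l) = Nat.card φ.ker := fun q =>
    map_natCast (MulSemiringAction.toRingHom Q l q) _
  refine ⟨a * (b * Nat.card φ.ker)⁻¹, ?_⟩
  rw [← Equiv.sum_comp (kerProdEquiv φ s hs), Fintype.sum_prod_type]
  simp only [map_kerProdEquiv, smul_mul', smul_inv'', hb, hn, ← Finset.sum_mul, Finset.sum_const,
    Finset.card_univ, nsmul_eq_mul, ← Nat.card_eq_fintype_card]
  change (_ * b) * (b * _)⁻¹ = 1
  field_simp

/-- If `G` acts on a field `l` through a split quotient `Q` which acts faithfully, the sum of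
the twists of `l` by the powers of a crossed character `χ` which is injective on the kernel is the
regular representation over the fixed field. -/
theorem exists_addEquiv_twist {l G Q : Type*} [Field l] [Group G] [Finite G] [Group Q]
    [MulSemiringAction Q l] [FaithfulSMul Q l] (φ : G →* Q) (s : Q →* G)
    (hs : ∀ q, φ (s q) = q) (χ : G → l) (hχ : ∀ g h, χ (g * h) = χ g * φ g • χ h)
    (hχs : ∀ q, χ (s q) = 1)
    (hχi : ∀ t t', φ t = 1 → φ t' = 1 → χ t = χ t' → t = t') :
    ∃ Φ : (G → FixedPoints.subfield Q l) ≃+ (Fin (Nat.card φ.ker) → l),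
      ∀ g x i, Φ (fun h => x (g⁻¹ * h)) i = χ g ^ (i : ℕ) * φ g • Φ x i := by
  classical
  have := Fintype.ofFinite G
  have hφ : Function.Surjective φ := fun q => ⟨s q, hs q⟩
  have : Finite Q := Finite.of_surjective φ hφ
  have := Fintype.ofFinite Q
  set κ := FixedPoints.subfield Q l
  obtain ⟨α, hα⟩ := exists_linearIndependent_algEquiv_apply κ l
  have hα' : LinearIndependent κ fun q : Q => q • α :=
    hα.comp (fun q => MulSemiringAction.toAlgEquiv κ l q) fun q q' h =>
      eq_of_smul_eq_smul fun x => DFunLike.congr_fun h x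
  -- The basis vector at `h` goes to the translate by `h` of `(α, ..., α)`, where `α` generates a
  -- normal basis.
  let Φ : (G → κ) →ₗ[κ] (Fin (Nat.card φ.ker) → l) :=
    LinearMap.pi fun i => ∑ h, (LinearMap.proj h).smulRight (χ h ^ (i : ℕ) * φ h • α)
  have hΦ : ∀ x i, Φ x i = ∑ h, x h • (χ h ^ (i : ℕ) * φ h • α) := fun x i => by
    simp [Φ, LinearMap.sum_apply]
  have hinj : Function.Injective Φ := by
    rw [injective_iff_map_eq_zero]
    intro x hx
    let e := kerProdEquiv φ s hs
    let n := Fintype.equivFinOfCardEq (Fintype.card_eq_nat_card (α := φ.ker))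
    -- Vandermonde in the distinct values of `χ` on the kernel separates the kernel coordinate; the
    -- normal basis then separates the `Q` coordinate.
    have key : (fun j => ∑ q, x (e (n.symm j, q)) • q • α) = 0 := by
      refine Matrix.eq_zero_of_forall_pow_sum_mul_pow_eq_zero
        (f := fun j => χ (n.symm j : φ.ker)) (fun a b h => ?_) fun i => ?_
      · exact n.symm.injective (Subtype.ext (hχi _ _ (n.symm a).2 (n.symm b).2 h))
      · have := congrFun hx i
        rw [hΦ, ← Equiv.sum_comp e, Fintype.sum_prod_type, ← Equiv.sum_comp n.symm] at this
        rw [← Pi.zero_apply (M := fun _ => l) i, ← this]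
        refine Finset.sum_congr rfl fun j _ => ?_
        rw [Finset.sum_mul]
        refine Finset.sum_congr rfl fun q _ => ?_
        rw [crossedHom_kerProdEquiv φ s hs χ hχ hχs, map_kerProdEquiv, mul_comm (χ _ ^ _),
          smul_mul_assoc]
    funext g
    obtain ⟨⟨t, q⟩, rfl⟩ := e.surjective g
    have := congrFun key (n t)
    simp only [Equiv.symm_apply_apply, Pi.zero_apply] at this
    exact Fintype.linearIndependent_iff.1 hα' (fun q => x (e (t, q))) this q
  have hbij : Function.Bijective Φ := by
    refine ⟨hinj, (LinearMap.injective_iff_surjective_of_finrank_eq_finrank ?_).1 hinj⟩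
    -- Both sides have `κ`-dimension `|G| = |ker φ| * |Q|`, since `[l : κ] = |Q|`.
    rw [Module.finrank_pi, Module.finrank_pi_fintype]
    simp only [Finset.sum_const, Finset.card_univ, Fintype.card_fin, smul_eq_mul]
    rw [FixedPoints.finrank_eq_card Q l, Fintype.card_eq_nat_card, Fintype.card_eq_nat_card,
      ← φ.ker.card_mul_index, Subgroup.index_ker, MonoidHom.range_eq_top.2 hφ, Subgroup.card_top]
  refine ⟨(LinearEquiv.ofBijective Φ hbij).toAddEquiv, fun g x i => ?_⟩
  change Φ _ i = _ * _ • Φ x i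
  rw [hΦ, hΦ, ← Equiv.sum_comp (Equiv.mulLeft g), Finset.smul_sum, Finset.mul_sum]
  refine Finset.sum_congr rfl fun h _ => ?_
  simp only [Equiv.coe_mulLeft, inv_mul_cancel_left, hχ, map_mul, mul_smul, smul_mul', smul_pow',
    mul_pow, Algebra.smul_def]
  have : φ g • algebraMap κ l (x h) = algebraMap κ l (x h) := (x h).2 (φ g)
  rw [this]
  ring

end Twist

/-! ### Countable reindexing. -/

section Countable

/-- A basis gives `k ≃ 𝔽_p ^ d`, and `ℕ × Fin d ≃ ℕ`. -/
theorem exists_addEquiv_nat_pi_zmod (p : ℕ) [Fact p.Prime] (k : Type*) [Field k] [Finite k]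
    [CharP k p] : Nonempty ((ℕ → k) ≃+ (ℕ → ZMod p)) := by
  let := ZMod.algebra k p
  have : Module.Finite (ZMod p) k := inferInstance
  let e := (Module.finBasis (ZMod p) k).equivFun
  have : NeZero (Module.finrank (ZMod p) k) := ⟨Module.finrank_pos.ne'⟩
  let n : ℕ × Fin (Module.finrank (ZMod p) k) ≃ ℕ :=
    (nonempty_denumerable _).some.eqv
  exact ⟨(AddEquiv.piCongrRight fun _ => e.toAddEquiv).trans
    ((LinearEquiv.curry (ZMod p) (ZMod p) ℕ _).symm.trans
      (LinearEquiv.funCongrLeft (ZMod p) (ZMod p) n.symm)).toAddEquiv⟩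

theorem exists_equiv_not_dvd {p e : ℕ} (hp : p.Prime) (h : p.Coprime e) (he : e ≠ 0) :
    ∃ n : ℕ × Fin e ≃ {j : ℕ | ¬ p ∣ j}, ∀ a, (n a : ℕ) % e = a.2 := by
  have := NeZero.mk he
  let f : {j : ℕ | ¬ p ∣ j} → Fin e := fun j => Fin.ofNat e j
  have hinf : ∀ i : Fin e, Infinite {j // f j = i} := fun i => by
    -- All `x + n * p * e` are `1` modulo `p` and `i` modulo `e`, so every fibre of reduction modulo
    -- `e` is infinite.
    obtain ⟨x, hx1, hxi⟩ := Nat.chineseRemainder h 1 i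
    refine Infinite.of_injective (β := ℕ) (fun n => ⟨⟨x + n * (p * e), fun hd => hp.ne_one ?_⟩, ?_⟩) ?_
    · have h1 : p ∣ x := (Nat.dvd_add_left ((dvd_mul_right p e).mul_left n)).1 hd
      exact Nat.dvd_one.1 ((Nat.ModEq.dvd_iff hx1 dvd_rfl).1 h1)
    · apply Fin.ext
      change (x + n * (p * e)) % e = i
      rw [← mul_assoc, Nat.add_mul_mod_self_right, hxi, Nat.mod_eq_of_lt i.2]
    · intro a b hab
      simp only [Subtype.mk.injEq] at hab
      exact Nat.eq_of_mul_eq_mul_right (Nat.mul_pos hp.pos (Nat.pos_of_ne_zero he))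
        (Nat.add_left_cancel hab)
  have hden : ∀ i : Fin e, Nonempty (ℕ ≃ {j // f j = i}) := fun i =>
    ⟨(nonempty_denumerable _).some.eqv.symm⟩
  let n := (Equiv.prodComm ℕ (Fin e)).trans ((Equiv.sigmaEquivProd (Fin e) ℕ).symm.trans
    ((Equiv.sigmaCongrRight fun i => (hden i).some).trans (Equiv.sigmaFiberEquiv f)))
  refine ⟨n, fun a => ?_⟩
  exact congrArg Fin.val ((hden a.2).some a.1).2

end Countable

/-! ### The unit filtration modulo `p`-th powers. -/

section UnitFiltration

open IsLocalRing

variable {p : ℕ} [Fact p.Prime] {R : Type*} [CommRing R] [IsDomain R] [IsDiscreteValuationRing R]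
  {X : Type*} [AddCommGroup X] [Module (ZMod p) X]

/-- The `i`-th group of principal units of `R`. -/
def higherUnits (R : Type*) [CommRing R] [IsLocalRing R] (i : ℕ) : Subgroup Rˣ where
  -- The intersection matters only for `i = 0`: levels `0` and `1` coincide, and level `0` is not
  -- all of `Rˣ`.
  carrier := {u | (u : R) - 1 ∈ maximalIdeal R ⊓ maximalIdeal R ^ i}
  one_mem' := by simp
  mul_mem' := fun {u v} hu hv => by
    have : ((u * v : Rˣ) : R) - 1 = (u - 1) * v + (v - 1) := by push_cast; ring
    rw [Set.mem_ofPred_eq, this]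
    exact add_mem (Ideal.mul_mem_right _ _ hu) hv
  inv_mem' := fun {u} hu => by
    have : ((u⁻¹ : Rˣ) : R) - 1 = -((u - 1) * (u⁻¹ : Rˣ)) := by rw [sub_mul]; simp
    rw [Set.mem_ofPred_eq, this]
    exact neg_mem (Ideal.mul_mem_right _ _ hu)

/-- The image in `X` of the `i`-th group of principal units of `R`. -/
def unitFiltration (q : Additive Rˣ →+ X) (i : ℕ) : Submodule (ZMod p) X :=
  AddSubgroup.toZModSubmodule p ((Subgroup.toAddSubgroup (higherUnits R i)).map q)

theorem mem_unitFiltration {q : Additive Rˣ →+ X} {i : ℕ} {x : X} :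
    x ∈ unitFiltration (p := p) q i ↔ ∃ u : Rˣ, (u : R) - 1 ∈ maximalIdeal R ∧
      (u : R) - 1 ∈ maximalIdeal R ^ i ∧ q (Additive.ofMul u) = x := by
  constructor
  · rintro ⟨u, hu, rfl⟩
    exact ⟨u.toMul, hu.1, hu.2, rfl⟩
  · rintro ⟨u, h1, h2, rfl⟩
    exact ⟨Additive.ofMul u, ⟨h1, h2⟩, rfl⟩

theorem unitFiltration_succ_le (q : Additive Rˣ →+ X) (i : ℕ) :
    unitFiltration (p := p) q (i + 1) ≤ unitFiltration q i := fun x hx => by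
  rw [mem_unitFiltration] at hx ⊢
  obtain ⟨u, h1, h2, rfl⟩ := hx
  exact ⟨u, h1, Ideal.pow_le_pow_right i.le_succ h2, rfl⟩

theorem exists_unit_of_sub_one_mem {x : R} (hx : x - 1 ∈ maximalIdeal R) :
    ∃ u : Rˣ, (u : R) = x := by
  have : IsUnit x := by
    by_contra h
    have h1 : (1 : R) ∈ maximalIdeal R := by
      have := sub_mem (show x ∈ maximalIdeal R from h) hx
      rwa [sub_sub_cancel] at this
    exact (Ideal.ne_top_iff_one _).1 (maximalIdeal.isMaximal R).ne_top h1
  exact this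

theorem mem_maximalIdeal_pow_iff {ϖ : R} (hϖ : Irreducible ϖ) {n : ℕ} {x : R} :
    x ∈ maximalIdeal R ^ n ↔ ∃ a, x = a * ϖ ^ n := by
  rw [hϖ.maximalIdeal_eq, Ideal.span_singleton_pow, Ideal.mem_span_singleton']
  exact exists_congr fun _ => eq_comm

/-- In a discrete valuation ring, a `p`-th power has valuation divisible by `p`. -/
theorem mem_maximalIdeal_of_pow_eq {ϖ : R} (hϖ : Irreducible ϖ) {i : ℕ} (hi : ¬ p ∣ i) {a z : R}
    (h : z ^ p = a * ϖ ^ i) : a ∈ maximalIdeal R := by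
  by_contra ha
  have ha' : IsUnit a := by simpa using ha
  have hv := congrArg (IsDiscreteValuationRing.addVal R) h
  have hϖ1 : IsDiscreteValuationRing.addVal R ϖ = 1 := IsDiscreteValuationRing.addVal_uniformizer hϖ
  rw [AddValuation.map_mul, AddValuation.map_pow, AddValuation.map_pow, hϖ1,
    IsDiscreteValuationRing.addVal_eq_zero_iff.2 ha', zero_add, nsmul_one] at hv
  cases hz : IsDiscreteValuationRing.addVal R z with
  | top =>
    rw [hz, nsmul_eq_mul, ENat.mul_top (by exact_mod_cast (Fact.out : p.Prime).ne_zero)] at hv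
    exact ENat.top_ne_natCast _ hv
  | coe n =>
    rw [hz, nsmul_eq_mul] at hv
    exact hi ⟨n, by exact_mod_cast hv.symm⟩

theorem mem_maximalIdeal_pow_of_pow_mem {z : R} {n : ℕ}
    (h : z ^ p ∈ maximalIdeal R ^ (p * n)) : z ∈ maximalIdeal R ^ n := by
  obtain ⟨ϖ, hϖ⟩ := IsDiscreteValuationRing.exists_irreducible R
  rw [hϖ.maximalIdeal_eq, Ideal.span_singleton_pow, Ideal.mem_span_singleton] at h ⊢
  rw [mul_comm, pow_mul] at h
  exact (UniqueFactorizationMonoid.pow_dvd_pow_iff_dvd (Fact.out : p.Prime).ne_zero).1 h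

theorem eq_zero_of_forall_mem_maximalIdeal_pow {x : R} (h : ∀ n, x ∈ maximalIdeal R ^ n) :
    x = 0 :=
  IsHausdorff.haus' (I := maximalIdeal R) x fun n => by
    rw [SModEq.sub_mem, sub_zero]
    simpa using h n

theorem exists_sub_mem_maximalIdeal_pow [IsAdicComplete (maximalIdeal R) R] (f : ℕ → R)
    (hf : ∀ n, f (n + 1) - f n ∈ maximalIdeal R ^ n) :
    ∃ y, ∀ n, y - f n ∈ maximalIdeal R ^ n := by
  have hf' : ∀ {m n}, m ≤ n → f n - f m ∈ maximalIdeal R ^ m := fun {m n} h => by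
    induction n, h using Nat.le_induction with
    | base => simp
    | succ n h ih =>
      rw [← sub_add_sub_cancel (f (n + 1)) (f n)]
      exact add_mem (Ideal.pow_le_pow_right h (hf n)) ih
  obtain ⟨y, hy⟩ := IsPrecomplete.prec' (I := maximalIdeal R) f fun {m n} h => by
    rw [SModEq.sub_mem, ← neg_mem_iff, neg_sub]
    simpa using hf' h
  refine ⟨y, fun n => ?_⟩
  have := hy n
  rw [SModEq.sub_mem, ← neg_mem_iff, neg_sub] at this
  simpa using this

/-- Completeness of the filtration: lift the terms to units and take the limit of their partial
products. -/
theorem exists_sub_sum_mem_unitFiltration [IsAdicComplete (maximalIdeal R) R]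
    (q : Additive Rˣ →+ X) (x : ℕ → X)
    (hx : ∀ i, x i ∈ unitFiltration (p := p) q i) :
    ∃ y ∈ unitFiltration (p := p) q 0,
      ∀ n, y - ∑ j ∈ Finset.range n, x j ∈ unitFiltration (p := p) q n := by
  simp_rw [mem_unitFiltration] at hx ⊢
  choose u hu hui hux using hx
  let P : ℕ → Rˣ := fun n => ∏ j ∈ Finset.range n, u j
  have hP : ∀ n, (P n : R) - 1 ∈ maximalIdeal R := fun n => by
    induction n with
    | zero => simp [P]
    | succ n ih =>
      have : (P (n + 1) : R) - 1 = (P n - 1) * u n + (u n - 1) := by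
        simp only [P, Finset.prod_range_succ]; push_cast; ring
      rw [this]
      exact add_mem (Ideal.mul_mem_right _ _ ih) (hu n)
  obtain ⟨y, hy⟩ := exists_sub_mem_maximalIdeal_pow (fun n => (P n : R)) fun n => by
    have : (P (n + 1) : R) - P n = P n * (u n - 1) := by
      simp only [P, Finset.prod_range_succ]; push_cast; ring
    rw [this]
    exact Ideal.mul_mem_left _ _ (hui n)
  have hy1 : y - 1 ∈ maximalIdeal R := by
    rw [← sub_add_sub_cancel _ (P 1 : R)]
    exact add_mem (by simpa using hy 1) (hP 1)
  obtain ⟨v, rfl⟩ := exists_unit_of_sub_one_mem hy1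
  refine ⟨q (Additive.ofMul v), ⟨v, hy1, by simp, rfl⟩, fun n => ⟨v * (P n)⁻¹, ?_, ?_, ?_⟩⟩
  · have : ((v * (P n)⁻¹ : Rˣ) : R) - 1 = ((v - 1) - (P n - 1)) * ((P n)⁻¹ : Rˣ) := by
      rw [Units.val_mul, sub_sub_sub_cancel_right, sub_mul, Units.mul_inv]
    rw [this]
    exact Ideal.mul_mem_right _ _ (sub_mem hy1 (hP n))
  · have : ((v * (P n)⁻¹ : Rˣ) : R) - 1 = (v - P n) * ((P n)⁻¹ : Rˣ) := by
      rw [Units.val_mul, sub_mul, Units.mul_inv]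
    rw [this]
    exact Ideal.mul_mem_right _ _ (hy n)
  · rw [ofMul_mul, ofMul_inv, map_add, map_neg, ← sub_eq_add_neg]
    simp only [P, ofMul_prod, map_sum, hux]

variable [CharP R p]

/-- The reduction of `a` is determined by the class of `1 + a ϖ ^ i`, for `i` prime to `p`. -/
theorem exists_residue_linearMap [Module (ZMod p) (ResidueField R)]
    (q : Additive Rˣ →+ X) (hq : ∀ u, q (Additive.ofMul u) = 0 → ∃ w : Rˣ, w ^ p = u)
    {ϖ : R} (hϖ : Irreducible ϖ) {i : ℕ} (hi : ¬ p ∣ i) :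
    ∃ f : X →ₗ[ZMod p] ResidueField R, ∀ (u : Rˣ) (a : R), (u : R) = 1 + a * ϖ ^ i →
      f (q (Additive.ofMul u)) = residue R a := by
  have hi0 : i ≠ 0 := by rintro rfl; exact hi (dvd_zero p)
  have hϖ0 : residue R ϖ = 0 := (residue_eq_zero_iff _).2 hϖ.1
  -- The graph of class of `1 + a ϖ ^ i` ↦ residue of `a`. It is additive because `i ≠ 0` makes the
  -- cross term `a b ϖ ^ i` vanish in the residue field.
  let Γ : AddSubgroup (X × ResidueField R) :=
    { carrier := {y | ∃ (u : Rˣ) (a : R), (u : R) = 1 + a * ϖ ^ i ∧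
        y = (q (Additive.ofMul u), residue R a)}
      zero_mem' := ⟨1, 0, by simp, by simp; rfl⟩
      add_mem' := by
        rintro _ _ ⟨u, a, hu, rfl⟩ ⟨v, b, hv, rfl⟩
        refine ⟨u * v, a + b + a * b * ϖ ^ i, by push_cast; rw [hu, hv]; ring, ?_⟩
        simp [hϖ0, hi0]
      neg_mem' := by
        rintro _ ⟨u, a, hu, rfl⟩
        have h1 : (u : R) * (u⁻¹ : Rˣ) = 1 := by simp
        refine ⟨u⁻¹, -a * (u⁻¹ : Rˣ), ?_, ?_⟩
        · rw [hu] at h1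
          linear_combination h1
        · have h2 : residue R (u : R) = 1 := by rw [hu]; simp [hϖ0, hi0]
          have h3 := congrArg (residue R) h1
          rw [map_mul, h2, one_mul, map_one] at h3
          simp [h3] }
  obtain ⟨f, hf⟩ := exists_linearMap_of_graph (AddSubgroup.toZModSubmodule p Γ) (by
    rintro w ⟨u, a, hu, h⟩
    rw [Prod.mk.injEq] at h
    obtain ⟨w, rfl⟩ := hq u h.1.symm
    rw [h.2, residue_eq_zero_iff]
    -- In characteristic `p`, `u = w ^ p` gives `(w - 1) ^ p = a ϖ ^ i`; as `p ∤ i`, `a` cannot be a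
    -- unit.
    refine mem_maximalIdeal_of_pow_eq hϖ hi (z := (w : R) - 1) ?_
    rw [sub_pow_char, one_pow, ← Units.val_pow_eq_pow_val, hu, add_sub_cancel_left])
  exact ⟨f, fun u a hu => hf _ _ ⟨u, a, hu, rfl⟩⟩

/-- As the residue field is perfect, `a ≡ b ^ p`, and dividing `1 + a ϖ ^ (p j)` by `(1 + b ϖ ^ j) ^
p` raises the level without changing the class. -/
theorem unitFiltration_le_succ_of_dvd [Finite (ResidueField R)] (q : Additive Rˣ →+ X)
    {i : ℕ} (hi : p ∣ i) : unitFiltration (p := p) q i ≤ unitFiltration q (i + 1) := by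
  intro x hx
  obtain ⟨ϖ, hϖ⟩ := IsDiscreteValuationRing.exists_irreducible R
  rw [mem_unitFiltration] at hx ⊢
  obtain ⟨u, h1, h2, rfl⟩ := hx
  obtain ⟨j, rfl⟩ := hi
  rcases Nat.eq_zero_or_pos j with rfl | hj
  · exact ⟨u, h1, by simpa using h1, rfl⟩
  have hchar : CharP (ResidueField R) p :=
    (CharP.charP_iff_prime_eq_zero (Fact.out : p.Prime)).2 (by
      rw [← map_natCast (residue R), CharP.cast_eq_zero, map_zero])
  obtain ⟨a, ha⟩ := (mem_maximalIdeal_pow_iff hϖ).1 h2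
  obtain ⟨b, hb⟩ : ∃ b : R, a - b ^ p ∈ maximalIdeal R := by
    obtain ⟨b', hb'⟩ := (bijective_frobenius (ResidueField R) p).2 (residue R a)
    obtain ⟨b, rfl⟩ := residue_surjective b'
    refine ⟨b, ?_⟩
    rw [← residue_eq_zero_iff, map_sub, map_pow, ← hb', frobenius_def, sub_self]
  obtain ⟨w, hw⟩ := exists_unit_of_sub_one_mem (x := 1 + b * ϖ ^ j) (by
    rw [add_sub_cancel_left]
    exact Ideal.mul_mem_left _ _ (Ideal.pow_mem_of_mem _ hϖ.1 _ hj))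
  have hwp : ((w ^ p : Rˣ) : R) = 1 + b ^ p * ϖ ^ (p * j) := by
    rw [Units.val_pow_eq_pow_val, hw, add_pow_char, one_pow, mul_pow, ← pow_mul, mul_comm j]
  have h3 : ((u * (w ^ p)⁻¹ : Rˣ) : R) - 1 = ((w ^ p)⁻¹ : Rˣ) * ((a - b ^ p) * ϖ ^ (p * j)) := by
    have h4 : (((w ^ p)⁻¹ : Rˣ) : R) * (w ^ p : Rˣ) = 1 := Units.inv_mul _
    rw [hwp] at h4
    have hu : (u : R) = 1 + a * ϖ ^ (p * j) := by rw [← ha]; ring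
    rw [Units.val_mul, hu]
    linear_combination h4
  have h5 : ((u * (w ^ p)⁻¹ : Rˣ) : R) - 1 ∈ maximalIdeal R ^ (p * j + 1) := by
    rw [h3, pow_succ']
    exact Ideal.mul_mem_left _ _ (Ideal.mul_mem_mul hb (Ideal.pow_mem_pow hϖ.1 _))
  refine ⟨u * (w ^ p)⁻¹, Ideal.pow_le_self (Nat.succ_ne_zero _) h5, h5, ?_⟩
  have hp : p • q (Additive.ofMul w) = 0 := by
    rw [← Nat.cast_smul_eq_nsmul (ZMod p), CharP.cast_eq_zero, zero_smul]
  rw [ofMul_mul, ofMul_inv, ofMul_pow, map_add, map_neg, map_nsmul, hp, neg_zero, add_zero]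

/-- The `p`-th powers are closed: if `w_n ^ p → u`, then `(w_{n+1} - w_n) ^ p = w_{n+1} ^ p - w_n ^
p` shows that the `w_n` converge too. -/
theorem eq_zero_of_forall_mem_unitFiltration [IsAdicComplete (maximalIdeal R) R]
    (q : Additive Rˣ →+ X) (hq : ∀ u, q (Additive.ofMul u) = 0 → ∃ w : Rˣ, w ^ p = u) {x : X}
    (hx : ∀ i, x ∈ unitFiltration (p := p) q i) : x = 0 := by
  simp_rw [mem_unitFiltration] at hx
  obtain ⟨u, hu, -, rfl⟩ := hx 0
  have key : ∀ n : ℕ, ∃ w : Rˣ, (w : R) ^ p - u ∈ maximalIdeal R ^ (p * n) := fun n => by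
    obtain ⟨v, -, hv, hvu⟩ := hx (p * n)
    obtain ⟨w, hw⟩ := hq (u * v⁻¹) (by rw [ofMul_mul, ofMul_inv, map_add, map_neg, hvu]; abel)
    refine ⟨w, ?_⟩
    have h1 : (v : R) * (v⁻¹ : Rˣ) = 1 := by simp
    have : (w : R) ^ p - u = -(((v : R) - 1) * (u * (v⁻¹ : Rˣ))) := by
      rw [← Units.val_pow_eq_pow_val, hw, Units.val_mul]
      linear_combination (u : R) * h1
    rw [this]
    exact neg_mem (Ideal.mul_mem_right _ _ hv)
  choose w hw using key
  obtain ⟨z, hz⟩ := exists_sub_mem_maximalIdeal_pow (fun n => (w n : R)) fun n => by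
    refine mem_maximalIdeal_pow_of_pow_mem (p := p) ?_
    rw [sub_pow_char, ← sub_sub_sub_cancel_right _ _ (u : R)]
    exact sub_mem (Ideal.pow_le_pow_right (Nat.mul_le_mul_left p n.le_succ) (hw (n + 1))) (hw n)
  have hzu : z ^ p = u := by
    refine sub_eq_zero.1 (eq_zero_of_forall_mem_maximalIdeal_pow fun n => ?_)
    rw [← sub_add_sub_cancel _ ((w n : R) ^ p), ← sub_pow_char]
    have hp := (Fact.out : p.Prime)
    exact add_mem (Ideal.pow_mem_of_mem _ (hz n) p hp.pos)
      (Ideal.pow_le_pow_right (Nat.le_mul_of_pos_left n hp.pos) (hw n))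
  have hzunit : IsUnit z := (isUnit_pow_iff (Fact.out : p.Prime).ne_zero).1 (hzu ▸ u.isUnit)
  obtain ⟨z, rfl⟩ := hzunit
  have : u = z ^ p := Units.ext (by rw [← hzu, Units.val_pow_eq_pow_val])
  rw [this, ofMul_pow, map_nsmul, ← Nat.cast_smul_eq_nsmul (ZMod p), CharP.cast_eq_zero, zero_smul]

/-- The filtration of the principal units modulo `p`-th powers splits equivariantly if the action
on the residue field is relatively projective. -/
theorem exists_unitFiltration_bijOn [IsAdicComplete (maximalIdeal R) R] [Finite (ResidueField R)]
    [Module (ZMod p) (ResidueField R)] {G : Type*} [Group G] [Fintype G] [MulSemiringAction G R]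
    (q : Additive Rˣ →+ X) (hq : ∀ u, q (Additive.ofMul u) = 0 → ∃ w : Rˣ, w ^ p = u)
    (ρ : Representation (ZMod p) G X) (hρ : ∀ g u, ρ g (q (Additive.ofMul u)) =
      q (Additive.ofMul (Units.map (MulSemiringAction.toRingHom G R g : R →* R) u)))
    {ϖ : R} (hϖ : Irreducible ϖ) (v : G → Rˣ) (hv : ∀ g, g • ϖ = v g * ϖ)
    (c : ResidueField R) (hc : ∑ g : G, g • c = 1) :
    ∃ r : X →ₗ[ZMod p] ({j : ℕ | ¬ p ∣ j} → ResidueField R),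
      (∀ g x j, r (ρ g x) j = residue R (v g) ^ (j : ℕ) * g • r x j) ∧
        Set.BijOn r (unitFiltration (p := p) q 0 : Set X) Set.univ := by
  have hϖ0 := hϖ.ne_zero
  have hv1 : v 1 = 1 := Units.ext (mul_right_cancel₀ hϖ0 (by rw [← hv, one_smul]; simp))
  have hvmul : ∀ g h, (v (g * h) : R) = v g * g • (v h : R) := fun g h => by
    refine mul_right_cancel₀ hϖ0 ?_
    rw [← hv, mul_smul, hv h, smul_mul', hv g]
    ring
  let σ : ℕ → Representation (ZMod p) G (ResidueField R) := fun i =>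
    { toFun := fun g => (AddMonoidHom.mk' (fun w => residue R (v g) ^ i * g • w)
        fun a b => by rw [smul_add, mul_add]).toZModLinearMap p
      map_one' := by
        ext w
        change residue R (v 1) ^ i * (1 : G) • w = w
        simp [hv1]
      map_mul' := fun g h => by
        ext w
        change residue R (v (g * h)) ^ i * (g * h) • w =
          residue R (v g) ^ i * g • (residue R (v h) ^ i * h • w)
        rw [hvmul, map_mul, mul_pow, ResidueField.residue_smul, smul_mul', smul_pow', mul_smul,
          mul_assoc] }
  have hσ : ∀ i g w, σ i g w = residue R (v g) ^ i * g • w := fun _ _ _ => rfl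
  have hf : ∀ i : ℕ, ∃ f : X →ₗ[ZMod p] ResidueField R, ¬ p ∣ i → ∀ (u : Rˣ) (a : R),
      (u : R) = 1 + a * ϖ ^ i → f (q (Additive.ofMul u)) = residue R a := fun i => by
    by_cases hi : p ∣ i
    · exact ⟨0, fun h => absurd hi h⟩
    · obtain ⟨f, hf⟩ := exists_residue_linearMap (p := p) q hq hϖ hi
      exact ⟨f, fun _ => hf⟩
  choose f hf using hf
  have hmem : ∀ {i x}, x ∈ unitFiltration (p := p) q i →
      ∃ (u : Rˣ) (a : R), (u : R) = 1 + a * ϖ ^ i ∧ q (Additive.ofMul u) = x := fun {i x} hx => by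
    obtain ⟨u, -, hu, rfl⟩ := mem_unitFiltration.1 hx
    obtain ⟨a, ha⟩ := (mem_maximalIdeal_pow_iff hϖ).1 hu
    exact ⟨u, a, by rw [← ha]; ring, rfl⟩
  have hmem' : ∀ {i : ℕ} {u : Rˣ} {a : R}, i ≠ 0 → (u : R) = 1 + a * ϖ ^ i →
      q (Additive.ofMul u) ∈ unitFiltration (p := p) q i := fun {i u a} hi hu => by
    have : (u : R) - 1 ∈ maximalIdeal R ^ i :=
      (mem_maximalIdeal_pow_iff hϖ).2 ⟨a, by rw [hu]; ring⟩
    exact mem_unitFiltration.2 ⟨u, Ideal.pow_le_self hi this, this, rfl⟩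
  have hne : ∀ {i : ℕ}, ¬ p ∣ i → i ≠ 0 := by rintro _ hi rfl; exact hi (dvd_zero p)
  refine exists_equivariant_bijOn ρ (unitFiltration q) (unitFiltration_succ_le q)
    {j : ℕ | ¬ p ∣ j} σ ((AddMonoidHom.mulLeft c).toZModLinearMap p) ?_ f ?_ ?_ ?_ ?_
    (fun x => eq_zero_of_forall_mem_unitFiltration q hq) (exists_sub_sum_mem_unitFiltration q)
  · intro i w
    -- `σ i g` is semilinear over `g`, so the twist cancels and only the sum of the `g • c` remains,
    -- whatever `i` is.
    have key : ∀ g : G, σ i g (c * σ i g⁻¹ w) = g • c * w := fun g => by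
      have h1 : σ i g (σ i g⁻¹ w) = w := by
        rw [← Module.End.mul_apply, ← map_mul, mul_inv_cancel, map_one, Module.End.one_apply]
      nth_rewrite 2 [← h1]
      rw [hσ, hσ i g (σ i g⁻¹ w), smul_mul']
      ring
    change ∑ g, σ i g (c * σ i g⁻¹ w) = w
    rw [Finset.sum_congr rfl fun g _ => key g, ← Finset.sum_mul, hc, one_mul]
  · intro i hi g x hx
    obtain ⟨u, a, hu, rfl⟩ := hmem hx
    rw [hρ, hf i hi u a hu, hσ, hf i hi _ (v g ^ i * g • a), map_mul, map_pow,
      ResidueField.residue_smul]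
    change g • (u : R) = _
    rw [hu, smul_add, smul_one, smul_mul', smul_pow', hv]
    ring
  · intro i hi x hx
    constructor
    · obtain ⟨u, a, hu, rfl⟩ := hmem hx
      rw [hf i hi u a hu, residue_eq_zero_iff, hϖ.maximalIdeal_eq, Ideal.mem_span_singleton']
      rintro ⟨b, rfl⟩
      exact hmem' (Nat.succ_ne_zero i) (hu.trans (by ring))
    · intro hx'
      obtain ⟨u, a, hu, rfl⟩ := hmem hx'
      rw [hf i hi u (a * ϖ) (hu.trans (by ring)), residue_eq_zero_iff]
      exact Ideal.mul_mem_left _ _ hϖ.1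
  · intro i hi w
    obtain ⟨a, rfl⟩ := residue_surjective w
    obtain ⟨u, hu⟩ := exists_unit_of_sub_one_mem (x := 1 + a * ϖ ^ i) (by
      rw [add_sub_cancel_left]
      exact Ideal.mul_mem_left _ _ (Ideal.pow_mem_of_mem _ hϖ.1 _ (Nat.pos_of_ne_zero (hne hi))))
    exact ⟨_, hmem' (hne hi) hu, hf i hi u a hu⟩
  · intro i hi
    exact unitFiltration_le_succ_of_dvd q (not_not.1 hi)

end UnitFiltration

/-! ### The ring of integers as a complete discrete valuation ring. -/

section LocalField

open IsLocalRing

variable (K : Type*) [Field K] [ValuativeRel K] [TopologicalSpace K]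
  [IsNonarchimedeanLocalField K]
variable (L : Type*) [Field L] [Algebra K L] [FiniteDimensional K L]

instance [Algebra.IsSeparable K L] : Module.Finite 𝒪[K] (RingOfIntegers K L) :=
  IsIntegralClosure.finite 𝒪[K] K L (RingOfIntegers K L)

instance [Algebra.IsSeparable K L] : IsDedekindDomain (RingOfIntegers K L) :=
  integralClosure.isDedekindDomain 𝒪[K] K L

instance : IsFractionRing (RingOfIntegers K L) L :=
  integralClosure.isFractionRing_of_finite_extension K L

instance faithfulSMul_ringOfIntegers {L : Type*} [Field L] [Algebra K L] :
    FaithfulSMul 𝒪[K] (RingOfIntegers K L) :=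
  (faithfulSMul_iff_algebraMap_injective _ _).2 fun _ _ h =>
    Subtype.ext ((algebraMap K L).injective (congrArg (fun x : RingOfIntegers K L => (x : L)) h))

instance isLocalHom_algebraMap_ringOfIntegers :
    IsLocalHom (algebraMap 𝒪[K] (RingOfIntegers K L)) :=
  Algebra.IsIntegral.isLocalHom _ _

instance isTorsionFree_ringOfIntegers : Module.IsTorsionFree 𝒪[K] (RingOfIntegers K L) :=
  Module.isTorsionFree_iff_faithfulSMul.2 inferInstance

theorem not_isField_ringOfIntegers {L : Type*} [Field L] [Algebra K L] : ¬ IsField (RingOfIntegers K L) := fun h =>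
  IsDiscreteValuationRing.not_isField 𝒪[K]
    (isField_of_isIntegral_of_isField (FaithfulSMul.algebraMap_injective _ _) h)

instance [Algebra.IsSeparable K L] : IsDiscreteValuationRing (RingOfIntegers K L) :=
  ((IsDiscreteValuationRing.TFAE (RingOfIntegers K L) (not_isField_ringOfIntegers K)).out 0 2
    rfl rfl).2 inferInstance

instance [Algebra.IsSeparable K L] : Finite (ResidueField (RingOfIntegers K L)) :=
  ResidueField.finite_of_finite (R := 𝒪[K]) inferInstance

/-- Completeness comes from compactness: pulled back to a finite free module over the compact ring
`𝒪[K]`, the cosets `f i + 𝔭 ^ i` form a decreasing sequence of nonempty compact sets. -/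
instance [Algebra.IsSeparable K L] : IsAdicComplete (maxIdeal K L) (RingOfIntegers K L) where
  haus' := IsHausdorff.haus'
  prec' f hf := by
    let := IsTopologicalAddGroup.rightUniformSpace K
    have := isUniformAddGroup_of_addCommGroup (G := K)
    have : T2Space K := inferInstance
    obtain ⟨n, φ, hφ⟩ := Module.Finite.exists_fin' 𝒪[K] (RingOfIntegers K L)
    let N : ℕ → Submodule 𝒪[K] (Fin n → 𝒪[K]) := fun i =>
      ((maxIdeal K L ^ i).restrictScalars 𝒪[K]).comap φ
    have hN : ∀ i, IsCompact (N i : Set (Fin n → 𝒪[K])) := fun i =>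
      Submodule.isCompact_of_fg (IsNoetherian.noetherian _)
    choose x hx using fun i => hφ (f i)
    let S : ℕ → Set (Fin n → 𝒪[K]) := fun i => (fun y => x i + y) '' N i
    have hmem : ∀ i y, y ∈ S i ↔ φ y - f i ∈ maxIdeal K L ^ i := fun i y => by
      constructor
      · rintro ⟨z, hz, rfl⟩
        rw [map_add, hx, add_sub_cancel_left]
        exact hz
      · intro h
        refine ⟨y - x i, ?_, add_sub_cancel _ _⟩
        change φ (y - x i) ∈ maxIdeal K L ^ i
        rwa [map_sub, hx]
    have hS : ∀ i, IsCompact (S i) := fun i => (hN i).image (continuous_const.add continuous_id)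
    obtain ⟨y, hy⟩ := IsCompact.nonempty_iInter_of_sequence_nonempty_isCompact_isClosed S
      (fun i y hy => by
        rw [hmem] at hy ⊢
        rw [← sub_add_sub_cancel _ (f (i + 1))]
        have := (hf i.le_succ).symm
        rw [SModEq.sub_mem] at this
        exact add_mem (Ideal.pow_le_pow_right i.le_succ hy) (by simpa using this))
      (fun i => ⟨x i, 0, zero_mem _, add_zero _⟩) (hS 0) (fun i => (hS i).isClosed)
    refine ⟨φ y, fun i => ?_⟩
    have := (hmem i y).1 (Set.mem_iInter.1 hy i)
    rw [← neg_mem_iff, neg_sub] at this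
    rw [SModEq.sub_mem]
    simpa using this

instance (p : ℕ) [CharP K p] : CharP (RingOfIntegers K L) p :=
  have : CharP L p := charP_of_injective_algebraMap (algebraMap K L).injective p
  ⟨fun n => by
    rw [← CharP.cast_eq_zero_iff L p, ← Subtype.coe_inj]
    simp⟩

/-- In the tame case the order of the inertia group is prime to `p`. -/
theorem not_dvd_card_inertiaGroup [IsGalois K L] {p : ℕ} (h : IsTamelyRamified K L p) :
    ¬ p ∣ Nat.card (inertiaGroup K L) := by
  have : IsGaloisGroup Gal(L/K) 𝒪[K] (RingOfIntegers K L) :=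
    IsGaloisGroup.of_isFractionRing _ _ _ K L
  have : Finite (maximalIdeal 𝒪[K]).ResidueField :=
    have : Finite (𝒪[K] ⧸ maximalIdeal 𝒪[K]) := inferInstanceAs (Finite 𝓀[K])
    Finite.of_surjective _ (maximalIdeal 𝒪[K]).bijective_algebraMap_quotient_residueField.2
  have : Module.Flat 𝒪[K] (RingOfIntegers K L) :=
    have : Module.Free 𝒪[K] (RingOfIntegers K L) := inferInstance
    inferInstance
  rw [inertiaGroup, Ideal.card_inertia_eq_ramificationIdxIn (maximalIdeal 𝒪[K]) (maxIdeal K L),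
    Ideal.ramificationIdxIn_eq_ramificationIdx (maximalIdeal 𝒪[K]) (maxIdeal K L) Gal(L/K)]
  exact h

end LocalField

/-! ### Group actions on uniformizers. -/

section ActionOnDVR

open IsLocalRing

variable {R : Type*} [CommRing R] [IsDomain R] [IsDiscreteValuationRing R]

theorem exists_unit_smul_eq {G : Type*} [Group G] [MulSemiringAction G R] {ϖ : R}
    (hϖ : Irreducible ϖ) (g : G) : ∃ v : Rˣ, g • ϖ = v * ϖ := by
  have : Irreducible (g • ϖ) :=
    (MulEquiv.irreducible_iff (MulSemiringAction.toRingEquiv G R g)).2 hϖ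
  obtain ⟨v, hv⟩ := (IsDiscreteValuationRing.associated_of_irreducible R hϖ this)
  exact ⟨v, by rw [← hv, mul_comm]⟩

/-- If a finite group acts faithfully on the residue field, it fixes some uniformizer. -/
theorem exists_irreducible_smul_eq {Q : Type*} [Group Q] [Finite Q] [MulSemiringAction Q R]
    [FaithfulSMul Q (ResidueField R)] : ∃ ϖ : R, Irreducible ϖ ∧ ∀ q : Q, q • ϖ = ϖ := by
  have := Fintype.ofFinite Q
  obtain ⟨ϖ, hϖ⟩ := IsDiscreteValuationRing.exists_irreducible R
  choose v hv using fun q : Q => exists_unit_smul_eq hϖ q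
  -- The orbit sum of `a ϖ` is `(∑ v_q * q a) * ϖ`; independence of automorphisms provides `a`
  -- making the first factor a unit.
  obtain ⟨a', ha⟩ := exists_sum_mul_smul_ne_zero (fun q : Q => residue R (v q))
    ((residue_ne_zero_iff_isUnit _).2 (v 1).isUnit)
  obtain ⟨a, rfl⟩ := residue_surjective a'
  have hu : IsUnit (∑ q : Q, (v q : R) * q • a) := by
    rw [← residue_ne_zero_iff_isUnit, map_sum]
    simpa only [map_mul, ResidueField.residue_smul] using ha
  refine ⟨∑ q : Q, q • (a * ϖ), ?_, fun q => ?_⟩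
  · have : ∑ q : Q, q • (a * ϖ) = (∑ q : Q, (v q : R) * q • a) * ϖ := by
      rw [Finset.sum_mul]
      refine Finset.sum_congr rfl fun q _ => ?_
      rw [smul_mul', hv]
      ring
    rw [this]
    exact (irreducible_isUnit_mul hu).2 hϖ
  · simp only [Finset.smul_sum, ← mul_smul q]
    exact Equiv.sum_comp (Equiv.mulLeft q) fun q => q • (a * ϖ)

/-- An automorphism of finite order prime to the residue characteristic, which acts trivially on
the residue field and on the first graded piece, is trivial. -/
theorem smul_eq_of_residue_eq_one {G : Type*} [Group G] [MulSemiringAction G R] {ϖ : R}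
    (hϖ : Irreducible ϖ) {t : G} {v : Rˣ} (hv : t • ϖ = v * ϖ) (hv1 : residue R v = 1)
    (ht : ∀ w : ResidueField R, t • w = w) {n : ℕ} (hn : IsUnit (n : R)) (htn : t ^ n = 1)
    (x : R) : t • x = x := by
  have h1 : ∀ i, ∀ x ∈ maximalIdeal R ^ i, t • x - x ∈ maximalIdeal R ^ (i + 1) := fun i x hx => by
    obtain ⟨a, rfl⟩ := (mem_maximalIdeal_pow_iff hϖ).1 hx
    have h : t • a * (v : R) ^ i - a ∈ maximalIdeal R := by
      rw [← residue_eq_zero_iff, map_sub, map_mul, map_pow, hv1, one_pow, mul_one,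
        ResidueField.residue_smul, ht, sub_self]
    have : t • (a * ϖ ^ i) - a * ϖ ^ i = (t • a * (v : R) ^ i - a) * ϖ ^ i := by
      rw [smul_mul', smul_pow', hv]; ring
    rw [this, pow_succ']
    exact Ideal.mul_mem_mul h (Ideal.pow_mem_pow hϖ.1 _)
  have h2 : ∀ i, ∀ x ∈ maximalIdeal R ^ i, ∀ j : ℕ, t ^ j • x - x ∈ maximalIdeal R ^ (i + 1) :=
    fun i x hx j => by
    induction j with
    | zero => simp
    | succ j ih =>
      have : t ^ (j + 1) • x - x = (t • (t ^ j • x - x) - (t ^ j • x - x)) +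
          (t ^ j • x - x) + (t • x - x) := by
        rw [pow_succ', mul_smul, smul_sub]; ring
      rw [this]
      exact add_mem (add_mem (Ideal.pow_le_pow_right (Nat.le_succ _) (h1 _ _ ih)) ih) (h1 i x hx)
  -- The sum telescopes as `t ^ n = 1`. If `y = t x - x` lies in `𝔭 ^ i`, it is also congruent to `n
  -- y` modulo `𝔭 ^ (i + 1)`, so `y` climbs through all powers.
  have h3 : ∑ j ∈ Finset.range n, t ^ j • (t • x - x) = 0 := by
    have := Finset.sum_range_sub (fun j => t ^ j • x) n
    rw [htn, pow_zero, sub_self] at this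
    rw [← this]
    exact Finset.sum_congr rfl fun j _ => by rw [smul_sub, pow_succ, mul_smul]
  refine sub_eq_zero.1 (eq_zero_of_forall_mem_maximalIdeal_pow fun i => ?_)
  induction i with
  | zero => simp
  | succ i ih =>
    have h4 : (n : R) * (t • x - x) =
        -∑ j ∈ Finset.range n, (t ^ j • (t • x - x) - (t • x - x)) := by
      rw [Finset.sum_sub_distrib, h3, Finset.sum_const, Finset.card_range, nsmul_eq_mul]
      ring
    obtain ⟨u, hu⟩ := hn
    rw [← Ideal.unit_mul_mem_iff_mem _ ⟨u, rfl⟩, hu, h4]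
    exact neg_mem (sum_mem fun j _ => h2 i _ ih j)

end ActionOnDVR

/-- Scalars of `ZMod p` act as integer multiples, so only group elements need checking. -/
theorem nonempty_linearEquiv_of_addEquiv (p : ℕ) {G : Type*} [Group G] {M N : Type*} [AddCommGroup M] [AddCommGroup N]
    [Module (MonoidAlgebra (ZMod p) G) M] [Module (MonoidAlgebra (ZMod p) G) N] [NeZero p]
    (e : M ≃+ N) (he : ∀ g x, e (MonoidAlgebra.of (ZMod p) G g • x) =
      MonoidAlgebra.of (ZMod p) G g • e x) :
    Nonempty (M ≃ₗ[MonoidAlgebra (ZMod p) G] N) := by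
  refine ⟨{ e with map_smul' := fun a x => ?_ }⟩
  change e (a • x) = a • e x
  induction a using MonoidAlgebra.induction_on with
  | of g => exact he g x
  | add a b ha hb => rw [add_smul, add_smul, map_add, ha, hb]
  | smul c a ha =>
    obtain ⟨n, rfl⟩ := ZMod.natCast_zmod_surjective c
    rw [Nat.cast_smul_eq_nsmul, smul_assoc, smul_assoc, map_nsmul, ha]

/-! ### From units of the ring of integers to `Lˣ / Lˣᵖ`. -/

section Units

variable (p : ℕ) (K : Type*) [Field K] [ValuativeRel K] (L : Type*) [Field L] [Algebra K L]

/-- The map from the units of the ring of integers to `Lˣ / Lˣᵖ`. -/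
noncomputable def unitsToUnitsModPow : Additive (RingOfIntegers K L)ˣ →+ UnitsModPow p L :=
  (UnitsModPow.mk p L).comp
    (MonoidHom.toAdditive (Units.map (algebraMap (RingOfIntegers K L) L : _ →* L)))

/-- A `p`-th root in `L` of an integral unit is itself integral and a unit. -/
theorem exists_pow_eq_of_unitsToUnitsModPow_eq_zero [Fact p.Prime]
    (u : (RingOfIntegers K L)ˣ)
    (hu : unitsToUnitsModPow p K L (Additive.ofMul u) = 0) :
    ∃ w : (RingOfIntegers K L)ˣ, w ^ p = u := by
  obtain ⟨w, hw⟩ := (QuotientGroup.eq_one_iff _).1 hu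
  have hp := (Fact.out : p.Prime).ne_zero
  have hw' : (w : L) ^ p = (u : RingOfIntegers K L) := congrArg Units.val hw
  have hint : IsIntegral 𝒪[K] (w : L) :=
    IsIntegral.of_pow (Nat.pos_of_ne_zero hp) (hw' ▸ (u : RingOfIntegers K L).2)
  have h : (⟨w, hint⟩ : RingOfIntegers K L) ^ p = u := Subtype.ext hw'
  obtain ⟨z, hz⟩ := (isUnit_pow_iff hp).1 (h ▸ u.isUnit : IsUnit (_ ^ p))
  exact ⟨z, Units.ext (by rw [Units.val_pow_eq_pow_val, hz, h])⟩

theorem unitsRep_unitsToUnitsModPow (g : Gal(L/K)) (u : (RingOfIntegers K L)ˣ) :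
    unitsRep p L K g (unitsToUnitsModPow p K L (Additive.ofMul u)) =
      unitsToUnitsModPow p K L (Additive.ofMul
        (Units.map (MulSemiringAction.toRingHom Gal(L/K) (RingOfIntegers K L) g : _ →* _) u)) :=
  (UnitsModPow.map_mk g _).trans (congrArg (fun v => UnitsModPow.mk p L (Additive.ofMul v))
    (Units.ext rfl))

theorem eq_one_of_forall_smul_eq [FiniteDimensional K L] {g : Gal(L/K)} (h : ∀ x : RingOfIntegers K L, g • x = x) :
    g = 1 := by
  ext y
  obtain ⟨a, b, hb, rfl⟩ := IsFractionRing.div_surjective (RingOfIntegers K L) y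
  have : ∀ x : RingOfIntegers K L, g (algebraMap _ L x) = algebraMap _ L x := fun x =>
    congrArg (fun x : RingOfIntegers K L => (x : L)) (h x)
  rw [map_div₀, this, this, AlgEquiv.one_apply]

end Units

/-! ### Assembly of the isomorphism. -/

section LocalField

open IsLocalRing

variable (p : ℕ) [Fact p.Prime] (K : Type*) [Field K] [ValuativeRel K] [TopologicalSpace K]
  [IsNonarchimedeanLocalField K]
variable (L : Type*) [Field L] [Algebra K L] [FiniteDimensional K L]

theorem unitFiltration_zero_eq [Algebra.IsSeparable K L] :
    unitFiltration (p := p) (unitsToUnitsModPow p K L) 0 =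
      (principalUnitsSubrep p K L).toSubmodule := by
  ext x
  rw [mem_unitFiltration]
  constructor
  · rintro ⟨u, hu, -, rfl⟩
    refine ⟨Additive.ofMul (Units.map (algebraMap (RingOfIntegers K L) L : _ →* L) u),
      ⟨_, hu, ?_⟩, rfl⟩
    change ((u : RingOfIntegers K L) : L) = _
    push_cast
    ring
  · rintro ⟨u, ⟨x, hx, hu⟩, rfl⟩
    obtain ⟨v, hv⟩ := exists_unit_of_sub_one_mem (x := 1 + x) (by rwa [add_sub_cancel_left])
    refine ⟨v, by rwa [hv, add_sub_cancel_left], by simp, ?_⟩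
    refine congrArg (UnitsModPow.mk p L) (congrArg Additive.ofMul (a₂ := u.toMul) (Units.ext ?_))
    rw [hu]
    change ((v : RingOfIntegers K L) : L) = _
    rw [hv]
    rfl

theorem mem_inertiaGroup_iff (g : Gal(L/K)) :
    g ∈ inertiaGroup K L ↔ ∀ w : ResidueField (RingOfIntegers K L), g • w = w := by
  constructor
  · intro h w
    obtain ⟨x, rfl⟩ := residue_surjective w
    rw [← ResidueField.residue_smul, ← sub_eq_zero, ← map_sub, residue_eq_zero_iff]
    exact h x
  · intro h x
    change g • x - x ∈ maxIdeal K L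
    rw [← residue_eq_zero_iff, map_sub, ResidueField.residue_smul, h, sub_self]

theorem exists_addEquiv_UbarOne [CharP K p] [IsGalois K L] (htame : IsTamelyRamified K L p)
    (hsplit : IsSplit K L) :
    ∃ e : UbarOne p K L ≃+ (ℕ → Gal(L/K) → ZMod p), ∀ g x n h,
      e (MonoidAlgebra.of (ZMod p) Gal(L/K) g • x) n h = e x n (g⁻¹ * h) := by
  classical
  set R := RingOfIntegers K L
  set l := ResidueField R
  obtain ⟨s, hs⟩ := hsplit
  set T := inertiaGroup K L
  let φ : Gal(L/K) →* Gal(L/K) ⧸ T := QuotientGroup.mk' T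
  have hφT : ∀ g, φ g = 1 → g ∈ T := fun g => (QuotientGroup.eq_one_iff g).1
  have hker : Nat.card φ.ker = Nat.card T :=
    congrArg (fun H : Subgroup Gal(L/K) => Nat.card H) (QuotientGroup.ker_mk' T)
  let : MulSemiringAction (Gal(L/K) ⧸ T) R := MulSemiringAction.compHom R s
  have hsR : ∀ (q : Gal(L/K) ⧸ T) (x : R), q • x = s q • x := fun _ _ => rfl
  have hsl : ∀ (q : Gal(L/K) ⧸ T) (w : l), q • w = s q • w := fun q w => by
    obtain ⟨x, rfl⟩ := residue_surjective w
    rw [← ResidueField.residue_smul, ← ResidueField.residue_smul, hsR]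
  -- `g` and `s (φ g)` differ by an element of inertia, so on `l` the action through the section is
  -- the Galois action.
  have hφl : ∀ (g : Gal(L/K)) (w : l), φ g • w = g • w := fun g w => by
    have : (s (φ g))⁻¹ * g ∈ T := hφT _ (by
      rw [map_mul, map_inv, hs (φ g), inv_mul_cancel])
    rw [hsl, ← (mem_inertiaGroup_iff K L _).1 this w, ← mul_smul, mul_inv_cancel_left,
      (mem_inertiaGroup_iff K L _).1 this w]
  have : FaithfulSMul (Gal(L/K) ⧸ T) l := ⟨fun {q q'} h => by
    have : (s q)⁻¹ * s q' ∈ T := (mem_inertiaGroup_iff K L _).2 fun w => by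
      rw [mul_smul, ← hsl, ← h, hsl, inv_smul_smul]
    have h1 : φ ((s q)⁻¹ * s q') = 1 := (QuotientGroup.eq_one_iff _).2 this
    rwa [map_mul, map_inv, hs, hs, inv_mul_eq_one] at h1⟩
  have hpT : ¬ p ∣ Nat.card φ.ker := by
    rw [hker]
    exact not_dvd_card_inertiaGroup K L htame
  have hchar : CharP l p :=
    (CharP.charP_iff_prime_eq_zero (Fact.out : p.Prime)).2 (by
      rw [← map_natCast (residue R), CharP.cast_eq_zero, map_zero])
  have hcard : (Nat.card φ.ker : l) ≠ 0 := fun h => hpT ((CharP.cast_eq_zero_iff l p _).1 h)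
  obtain ⟨ϖ, hϖ, hϖs⟩ := exists_irreducible_smul_eq (R := R) (Q := Gal(L/K) ⧸ T)
  choose v hv using fun g : Gal(L/K) => exists_unit_smul_eq hϖ g
  have hvmul : ∀ g h, (v (g * h) : R) = v g * g • (v h : R) := fun g h => by
    refine mul_right_cancel₀ hϖ.ne_zero ?_
    rw [← hv, mul_smul, hv h, smul_mul', hv g]
    ring
  let χ : Gal(L/K) → l := fun g => residue R (v g)
  have hχ : ∀ g h, χ (g * h) = χ g * φ g • χ h := fun g h => by
    simp only [χ]
    rw [hvmul, map_mul, hφl, ResidueField.residue_smul]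
  have hχs : ∀ q, χ (s q) = 1 := fun q => by
    have : (v (s q) : R) = 1 := mul_right_cancel₀ hϖ.ne_zero (by
      rw [← hv, ← hsR, hϖs, one_mul])
    simp only [χ]
    rw [this, map_one]
  -- Tame inertia is detected by `χ`: `t * t'⁻¹` has order prime to `p` and acts trivially on all
  -- graded pieces.
  have hχi : ∀ t t', φ t = 1 → φ t' = 1 → χ t = χ t' → t = t' := fun t t' ht ht' h => by
    have hd : φ (t * t'⁻¹) = 1 := by rw [map_mul, map_inv, ht, ht', inv_one, one_mul]
    have hχd : χ (t * t'⁻¹) = 1 := by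
      have h1 := hχ (t * t'⁻¹) t'
      rw [inv_mul_cancel_right, hd, one_smul, h] at h1
      exact (right_eq_mul₀ ((residue_ne_zero_iff_isUnit _).2 (v t').isUnit)).1 h1
    have hn : IsUnit ((Nat.card φ.ker : ℕ) : R) := by
      rw [← residue_ne_zero_iff_isUnit, map_natCast]
      exact hcard
    refine mul_inv_eq_one.1 (eq_one_of_forall_smul_eq K L fun x =>
      smul_eq_of_residue_eq_one hϖ (hv (t * t'⁻¹)) hχd (fun w => ?_) hn ?_ x)
    · rw [← hφl, hd, one_smul]
    · exact congrArg Subtype.val (pow_card_eq_one' (x := (⟨t * t'⁻¹, hd⟩ : φ.ker)))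
  obtain ⟨c, hc⟩ := exists_sum_smul_eq_one (l := l) φ s hs hcard
  simp_rw [hφl] at hc
  let : Algebra (ZMod p) l := ZMod.algebra l p
  obtain ⟨r, hr, hbij⟩ := exists_unitFiltration_bijOn (p := p) (unitsToUnitsModPow p K L)
    (exists_pow_eq_of_unitsToUnitsModPow_eq_zero p K L) (unitsRep p L K)
    (unitsRep_unitsToUnitsModPow p K L) hϖ v hv c hc
  rw [unitFiltration_zero_eq] at hbij
  let e₁ : UbarOne p K L ≃+ ({j : ℕ | ¬ p ∣ j} → l) :=
    AddEquiv.ofBijective (AddMonoidHom.mk' (fun x : UbarOne p K L =>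
      r ((unitsRep p L K).asModuleEquiv x)) fun x y => by simp) (by
      constructor
      · intro x y h
        exact Subtype.ext (hbij.2.1 x.2 y.2 h)
      · intro w
        obtain ⟨x, hx, rfl⟩ := hbij.2.2 (Set.mem_univ w)
        exact ⟨⟨x, hx⟩, rfl⟩)
  have he₁ : ∀ g x j, e₁ (MonoidAlgebra.of (ZMod p) Gal(L/K) g • x) j =
      χ g ^ (j : ℕ) * φ g • e₁ x j := fun g x j => by
    rw [hφl]
    refine Eq.trans ?_ (hr g _ j)
    refine congrArg (fun y => r y j) ?_
    exact ((unitsRep p L K).asModuleEquiv_map_smul _ _).trans (by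
      rw [Representation.asAlgebraHom_of])
  obtain ⟨Φ, hΦ⟩ := exists_addEquiv_twist φ s hs χ hχ hχs hχi
  obtain ⟨n, hn⟩ := exists_equiv_not_dvd (Fact.out : p.Prime)
    (((Fact.out : p.Prime).coprime_iff_not_dvd).2 hpT) Nat.card_pos.ne'
  let κ := FixedPoints.subfield (Gal(L/K) ⧸ T) l
  have : CharP κ p := κ.subtype.charP κ.subtype_injective p
  obtain ⟨E⟩ := exists_addEquiv_nat_pi_zmod p κ
  let e₂ : ({j : ℕ | ¬ p ∣ j} → l) ≃+ (ℕ → Fin (Nat.card φ.ker) → l) :=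
    { toFun := fun y a i => y (n (a, i))
      invFun := fun y j => y (n.symm j).1 (n.symm j).2
      left_inv := fun y => by simp
      right_inv := fun y => by simp
      map_add' := fun _ _ => rfl }
  -- `E` is applied across the copies, separately at each group element, hence commutes with
  -- translation by `G`.
  let e₃ : (ℕ → Gal(L/K) → κ) ≃+ (ℕ → Gal(L/K) → ZMod p) :=
    { toFun := fun y a g => E (fun b => y b g) a
      invFun := fun y a g => E.symm (fun b => y b g) a
      left_inv := fun y => by simp
      right_inv := fun y => by simp
      map_add' := fun x y => by
        funext a g
        exact congrFun (map_add E (fun b => x b g) (fun b => y b g)) a }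
  let e₄ : (ℕ → Gal(L/K) → κ) ≃+ (ℕ → Fin (Nat.card φ.ker) → l) :=
    AddEquiv.piCongrRight fun _ => Φ
  have he₄ : ∀ (g : Gal(L/K)) (y : ℕ → Fin (Nat.card φ.ker) → l),
      e₄.symm (fun a i => χ g ^ (i : ℕ) * φ g • y a i) = fun a h => e₄.symm y a (g⁻¹ * h) :=
    fun g y => by
    rw [AddEquiv.symm_apply_eq]
    funext a i
    refine Eq.trans ?_ (hΦ g (e₄.symm y a) i).symm
    have : Φ (e₄.symm y a) = y a := congrFun (e₄.apply_symm_apply y) a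
    rw [this]
  refine ⟨e₁.trans (e₂.trans (e₄.symm.trans e₃)), fun g x a h => ?_⟩
  have h2 : e₂ (e₁ (MonoidAlgebra.of (ZMod p) Gal(L/K) g • x)) =
      fun a (i : Fin (Nat.card φ.ker)) => χ g ^ (i : ℕ) * φ g • e₂ (e₁ x) a i := by
    funext a i
    refine (he₁ g x _).trans ?_
    -- Only the exponent modulo `|ker φ|` matters, and `n (a, i)` was chosen congruent to `i`.
    rw [pow_eq_pow_mod (n (a, i) : ℕ) (crossedHom_pow_card_ker φ s hs χ hχ hχs g), hn]
    rfl
  change e₃ (e₄.symm (e₂ (e₁ _))) a h = e₃ (e₄.symm (e₂ (e₁ x))) a (g⁻¹ * h)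
  rw [h2, he₄]
  rfl

end LocalField

/-- For every finite field `k` of characteristic `p`, the module of principal units modulo `p`-th
powers is a countable product of copies of `k[G]`. -/
theorem nonempty_linearEquiv_UbarOne (p : ℕ) [Fact p.Prime]
    (K : Type*) [Field K] [ValuativeRel K] [TopologicalSpace K] [IsNonarchimedeanLocalField K]
    [CharP K p] (L : Type*) [Field L] [Algebra K L] [FiniteDimensional K L] [IsGalois K L]
    (htame : IsTamelyRamified K L p) (hsplit : IsSplit K L)
    (k : Type*) [Field k] [Finite k] [CharP k p]
    [Module (MonoidAlgebra (ZMod p) Gal(L/K)) (MonoidAlgebra k Gal(L/K))]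
    (hk : ∀ (g : Gal(L/K)) (y : MonoidAlgebra k Gal(L/K)),
      MonoidAlgebra.of (ZMod p) Gal(L/K) g • y = MonoidAlgebra.single g 1 * y) :
    Nonempty (UbarOne p K L ≃ₗ[MonoidAlgebra (ZMod p) Gal(L/K)]
      (ℕ → MonoidAlgebra k Gal(L/K))) := by
  obtain ⟨e, he⟩ := exists_addEquiv_UbarOne p K L htame hsplit
  obtain ⟨E⟩ := exists_addEquiv_nat_pi_zmod p k
  let e₁ : (ℕ → Gal(L/K) → ZMod p) ≃+ (ℕ → MonoidAlgebra k Gal(L/K)) :=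
    { toFun := fun y a => MonoidAlgebra.coeffAddEquiv.symm
        (Finsupp.equivFunOnFinite.symm fun g => E.symm (fun b => y b g) a)
      invFun := fun y a g => E (fun b => MonoidAlgebra.coeffAddEquiv (y b) g) a
      left_inv := fun y => by simp
      right_inv := fun y => by
        funext a
        rw [AddEquiv.symm_apply_eq]
        ext g
        simp
      map_add' := fun x y => by
        funext a
        rw [Pi.add_apply, ← map_add]
        congr 1
        ext g
        exact congrFun (map_add E.symm (fun b => x b g) (fun b => y b g)) a }
  have he₁ : ∀ y a g, (e₁ y a).coeff g = E.symm (fun b => y b g) a := fun _ _ _ => rfl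
  refine nonempty_linearEquiv_of_addEquiv p (e.trans e₁) fun g x => ?_
  funext a
  ext h
  rw [Pi.smul_apply, hk, MonoidAlgebra.coeff_single_mul_apply, one_mul]
  simp only [AddEquiv.trans_apply, he₁, he]

end LittleGalois

theorem mainTheorem3 (p : ℕ) [Fact p.Prime]
    (K : Type*) [Field K] [ValuativeRel K] [TopologicalSpace K] [IsNonarchimedeanLocalField K]
    [CharP K p]
    (L : Type*) [Field L] [Algebra K L] [FiniteDimensional K L] [IsGalois K L]
    (htame : LittleGalois.IsTamelyRamified K L p) (hsplit : LittleGalois.IsSplit K L) :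
    Nonempty (LittleGalois.UbarOne p K L
        ≃ₗ[MonoidAlgebra (ZMod p) Gal(L/K)] (ℕ → MonoidAlgebra 𝓀[K] Gal(L/K))) ∧
      Nonempty (LittleGalois.UbarOne p K L
        ≃ₗ[MonoidAlgebra (ZMod p) Gal(L/K)] (ℕ → MonoidAlgebra (ZMod p) Gal(L/K))) := by
  have := LittleGalois.charP_residueField p K
  refine ⟨LittleGalois.nonempty_linearEquiv_UbarOne p K L htame hsplit 𝓀[K] fun g y => ?_,
    LittleGalois.nonempty_linearEquiv_UbarOne p K L htame hsplit (ZMod p) fun g y => rfl⟩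
  change MonoidAlgebra.mapRingHom Gal(L/K) (ZMod.castHom (dvd_refl p) 𝓀[K])
    (MonoidAlgebra.of (ZMod p) Gal(L/K) g) * y = _
  rw [MonoidAlgebra.of_apply, MonoidAlgebra.mapRingHom_single, map_one]
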